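/- Let $n\ge 1$ be an integer and let $Q_n(8,4)$ be the Möbius octagonal-quadrilateral network: the simple graph with vertices $1,2,\dots,4n$ and $1',2',\dots,(4n)'$ whose edges are - $i\,(i+1)$ and $i'\,(i+1)'$ for $1\le i<4n$; - $i\,i'$ for $1\le i\le 4n$ with $i\equiv 0$ or $1 \pmod 4$; - $(4n)\,1'$ and $1\,(4n)'$. (This is the linear chain of $n$ octagons and $n$ quadrilaterals, alternating and consecutively sharing an edge, with its two end edges identified in reversed orientation.) For a connected graph $G$, let $r_{uv}$ be the resistance distance, i.e. the potential difference between $u$ and $v$ when every edge of $G$ is a unit resistor and a unit current enters at $u$ and leaves at $v$, and let $Kf(G)=\sum_{\{u,v\}} r_{uv}$, summed over all unordered pairs of distinct vertices, be the Kirchhoff index of $G$. Then $Q_n(8,4)$ is connected, has $8n$ vertices and $10n$ edges, and, with $\mu=15+4\sqrt{14}$ and $\nu=15-4\sqrt{14}$, $$Kf\big(Q_n(8,4)\big)=\frac{32n^3-2n}{3}+\frac{36n^2\sqrt{14}}{7}\cdot\frac{\mu^n-\nu^n}{\mu^n+\nu^n+2}.$$ -/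

import Mathlib

/-! ### Resistance distance and Kirchhoff index of a finite graph -/

/-- `x` is an electric potential on the network in which every edge of `G` is a unit resistor and a
unit current enters at `i` and leaves at `j`: by Ohm's law the current along an edge from `v` to `w`
is `x v - x w`, and by Kirchhoff's current law the net current flowing out of a vertex `v` equals
the external current supplied at `v`. -/
def IsUnitCurrentPotential {V : Type*} [Fintype V] [DecidableEq V] (G : SimpleGraph V)
    [DecidableRel G.Adj] (i j : V) (x : V → ℝ) : Prop :=
  ∀ v : V, ∑ w ∈ G.neighborFinset v, (x v - x w) =
    (if v = i then 1 else 0) - (if v = j then 1 else 0)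

open Classical in
/-- The resistance distance `r_{ij}`: the potential difference between `i` and `j` when a unit
current enters at `i` and leaves at `j`. In a connected graph such a potential exists
(`exists_isUnitCurrentPotential`), and its potential difference between `i` and `j` does not depend
on the choice (`resistanceDist_eq`). Without such a potential the value is `0` by convention. -/
noncomputable def resistanceDist {V : Type*} [Fintype V] [DecidableEq V] (G : SimpleGraph V)
    [DecidableRel G.Adj] (i j : V) : ℝ :=
  if h : ∃ x : V → ℝ, IsUnitCurrentPotential G i j x then h.choose i - h.choose j else 0

theorem isUnitCurrentPotential_iff {V : Type*} [Fintype V] [DecidableEq V] (G : SimpleGraph V)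
    [DecidableRel G.Adj] (i j : V) (x : V → ℝ) :
    IsUnitCurrentPotential G i j x ↔
      (G.lapMatrix ℝ).mulVec x = Pi.single i 1 - Pi.single j 1 := by
  unfold IsUnitCurrentPotential
  rw [funext_iff]
  refine forall_congr' fun v => ?_
  rw [SimpleGraph.lapMatrix_mulVec_apply, Finset.sum_sub_distrib, Finset.sum_const,
    SimpleGraph.card_neighborFinset_eq_degree, nsmul_eq_mul, Pi.sub_apply, Pi.single_apply,
    Pi.single_apply]

theorem resistanceDist_eq {V : Type*} [Fintype V] [DecidableEq V] (G : SimpleGraph V)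
    [DecidableRel G.Adj] {i j : V} {x : V → ℝ} (hx : IsUnitCurrentPotential G i j x) :
    resistanceDist G i j = x i - x j := by
  have key : ∀ y z : V → ℝ, IsUnitCurrentPotential G i j z →
      dotProduct y ((G.lapMatrix ℝ).mulVec z) = y i - y j := by
    intro y z hz
    rw [(isUnitCurrentPotential_iff G i j z).1 hz]
    simp [dotProduct_sub]
  have h : ∃ x : V → ℝ, IsUnitCurrentPotential G i j x := ⟨x, hx⟩
  rw [resistanceDist, dif_pos h, ← key _ x hx, ← key x _ h.choose_spec,
    Matrix.dotProduct_mulVec, dotProduct_comm, ← Matrix.mulVec_transpose,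
    (G.isSymm_lapMatrix (R := ℝ)).eq]

theorem exists_isUnitCurrentPotential {V : Type*} [Fintype V] [DecidableEq V] (G : SimpleGraph V)
    [DecidableRel G.Adj] (hG : G.Connected) (i j : V) :
    ∃ x : V → ℝ, IsUnitCurrentPotential G i j x := by
  classical
  let f : (V → ℝ) →ₗ[ℝ] (V → ℝ) := Matrix.toLin' (G.lapMatrix ℝ)
  let g : (V → ℝ) →ₗ[ℝ] ℝ := ∑ v : V, LinearMap.proj v
  have hg : ∀ y, g y = ∑ v, y v := fun y => by simp [g]
  have hker : Module.finrank ℝ (LinearMap.ker f) = 1 := by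
    rw [← SimpleGraph.card_connectedComponent_eq_finrank_ker_toLin'_lapMatrix,
      Fintype.card_eq_one_iff]
    refine ⟨G.connectedComponentMk i, fun c => ?_⟩
    induction c using SimpleGraph.ConnectedComponent.ind with
    | _ v => exact SimpleGraph.ConnectedComponent.sound (hG.preconnected v i)
  have hle : LinearMap.range f ≤ LinearMap.ker g := by
    rintro _ ⟨y, rfl⟩
    rw [LinearMap.mem_ker, hg]
    have h1 : ∑ v, f y v = dotProduct (fun _ => (1 : ℝ)) ((G.lapMatrix ℝ).mulVec y) := by
      simp [dotProduct, f]
    rw [h1, Matrix.dotProduct_mulVec, ← Matrix.mulVec_transpose,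
      (G.isSymm_lapMatrix (R := ℝ)).eq, SimpleGraph.lapMatrix_mulVec_const_eq_zero]
    simp
  have hgr : LinearMap.range g = ⊤ := by
    rw [LinearMap.range_eq_top]
    intro c
    exact ⟨Pi.single i c, by simp [hg]⟩
  have e1 := LinearMap.finrank_range_add_finrank_ker f
  have e2 := LinearMap.finrank_range_add_finrank_ker g
  rw [hgr, finrank_top, Module.finrank_self] at e2
  have heq := Submodule.eq_of_le_of_finrank_eq hle (by omega)
  have hmem : (Pi.single i 1 - Pi.single j 1 : V → ℝ) ∈ LinearMap.range f := by
    rw [heq, LinearMap.mem_ker, hg]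
    simp
  obtain ⟨x, hx⟩ := hmem
  exact ⟨x, (isUnitCurrentPotential_iff G i j x).2 (by simpa [f] using hx)⟩

/-- The Kirchhoff index, the sum of the resistance distances over all unordered pairs of vertices.
It is written as half of the sum over all ordered pairs; the diagonal terms vanish. -/
noncomputable def kirchhoffIndex {V : Type*} [Fintype V] [DecidableEq V] (G : SimpleGraph V)
    [DecidableRel G.Adj] : ℝ :=
  (∑ i : V, ∑ j : V, resistanceDist G i j) / 2

/-! ### The Möbius octagonal-quadrilateral network -/

/-- The edges of `Q_n(8,4)`, each listed at least once in one direction. The vertices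
`1, …, 4n` and `1', …, (4n)'` are `Sum.inl i` and `Sum.inr i` with the index `i` shifted to
`0, …, 4n - 1`. There are the two paths `1, 2, …, 4n` and `1', 2', …, (4n)'`; the rungs `i i'` for
`i ≡ 0, 1` modulo `4` (so that the columns `4k+1, …, 4k+4` carry an octagon, and the columns
`4k+4, 4k+5` a quadrilateral); and the two crossed edges `(4n) 1'` and `1 (4n)'`, which close the
strip up with a half twist. -/
def moebiusOctQuadRel (n : ℕ) : Fin (4 * n) ⊕ Fin (4 * n) → Fin (4 * n) ⊕ Fin (4 * n) → Prop
  | Sum.inl i, Sum.inl j => i.val + 1 = j.val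
  | Sum.inr i, Sum.inr j => i.val + 1 = j.val
  | Sum.inl i, Sum.inr j =>
      (i = j ∧ (i.val % 4 = 0 ∨ i.val % 4 = 3)) ∨
      (i.val + 1 = 4 * n ∧ j.val = 0) ∨ (i.val = 0 ∧ j.val + 1 = 4 * n)
  | Sum.inr _, Sum.inl _ => False

instance (n : ℕ) : DecidableRel (moebiusOctQuadRel n)
  | Sum.inl i, Sum.inl j => inferInstanceAs (Decidable (i.val + 1 = j.val))
  | Sum.inr i, Sum.inr j => inferInstanceAs (Decidable (i.val + 1 = j.val))
  | Sum.inl i, Sum.inr j => inferInstanceAs (Decidable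
      ((i = j ∧ (i.val % 4 = 0 ∨ i.val % 4 = 3)) ∨
      (i.val + 1 = 4 * n ∧ j.val = 0) ∨ (i.val = 0 ∧ j.val + 1 = 4 * n)))
  | Sum.inr _, Sum.inl _ => inferInstanceAs (Decidable False)

/-- The Möbius octagonal-quadrilateral network `Q_n(8,4)`, a simple graph on `8n` vertices. -/
def moebiusOctQuad (n : ℕ) : SimpleGraph (Fin (4 * n) ⊕ Fin (4 * n)) :=
  SimpleGraph.fromRel (moebiusOctQuadRel n)

instance (n : ℕ) : DecidableRel (moebiusOctQuad n).Adj :=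
  fun a b => inferInstanceAs
    (Decidable (a ≠ b ∧ (moebiusOctQuadRel n a b ∨ moebiusOctQuadRel n b a)))

/-! If `M` satisfies L M = I - c J for the Laplacian L and the all-ones matrix J, then Kf = |V| tr M
- (sum of the entries of M). Exchanging the two rows is an automorphism, so L splits. On symmetric
functions it is the Laplacian of the cycle of length 4n; on antisymmetric ones it is the operator
d_k x_k - x_{k+1} - x_{k-1}, with d_k = 4 at rungs and 2 elsewhere, and the half twist makes the
boundary condition antiperiodic. `cycleGreen` inverts the first part up to constants. For the
second, d has period 4 and the Floquet multipliers are μ and ν = 1/μ, so `antiGreen` is built from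
the two Floquet solutions and their Wronskian. The cycle part vanishes on the diagonal and the
antisymmetric part sums to zero: hence the entry sum gives the cubic term of Kf and the trace gives
the term in μ and ν. -/

open Finset

/-! ### The Kirchhoff index from a generalized inverse of the Laplacian -/

/-- If the columns of `M` are potentials for a unit current at each vertex with the same uniform
draining, then `M` determines the Kirchhoff index. -/
theorem kirchhoffIndex_eq_of_generalizedInverse {V : Type*} [Fintype V] [DecidableEq V]
    (G : SimpleGraph V) [DecidableRel G.Adj] (M : V → V → ℝ) (c : ℝ)
    (hM : ∀ v j, ∑ w ∈ G.neighborFinset v, (M v j - M w j) = (if v = j then 1 else 0) - c) :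
    kirchhoffIndex G = Fintype.card V * ∑ i, M i i - ∑ i, ∑ j, M i j := by
  have hr : ∀ i j, resistanceDist G i j = M i i + M j j - M i j - M j i := by
    intro i j
    -- The uniform drains `c` cancel in the difference of two columns.
    have hx : IsUnitCurrentPotential G i j (fun v => M v i - M v j) := by
      intro v
      have h1 := hM v i
      have h2 := hM v j
      rw [Finset.sum_sub_distrib] at h1 h2 ⊢
      rw [Finset.sum_sub_distrib, Finset.sum_sub_distrib]
      linarith
    rw [resistanceDist_eq G hx]
    ring
  have hcomm : ∑ i, ∑ j, M j i = ∑ i, ∑ j, M i j := Finset.sum_comm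
  simp only [kirchhoffIndex, hr, Finset.sum_sub_distrib, Finset.sum_add_distrib, hcomm,
    Finset.sum_const, Finset.card_univ, nsmul_eq_mul, ← Finset.mul_sum]
  ring

/-! ### The Hamiltonian cycle and the rungs of the network -/

namespace MoebiusOctQuad

variable {n : ℕ}

/-- The column of a vertex. -/
def col : Fin (4 * n) ⊕ Fin (4 * n) → Fin (4 * n) := Sum.elim id id

/-- The sign distinguishing the two rows. -/
def sgn : Fin (4 * n) ⊕ Fin (4 * n) → ℝ := Sum.elim (fun _ => 1) (fun _ => -1)

/-- The columns that carry a rung. -/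
def IsRung (k : ℤ) : Prop := k % 4 = 0 ∨ k % 4 = 3

instance : DecidablePred IsRung := fun k => inferInstanceAs (Decidable (k % 4 = 0 ∨ k % 4 = 3))

/-- The successor on the Hamiltonian cycle `1, …, 4n, 1', …, (4n)'`. -/
def next : Fin (4 * n) ⊕ Fin (4 * n) → Fin (4 * n) ⊕ Fin (4 * n)
  | Sum.inl i => if h : i.val + 1 < 4 * n then Sum.inl ⟨i.val + 1, h⟩ else Sum.inr ⟨0, i.pos⟩
  | Sum.inr i => if h : i.val + 1 < 4 * n then Sum.inr ⟨i.val + 1, h⟩ else Sum.inl ⟨0, i.pos⟩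

/-- The predecessor on the Hamiltonian cycle `1, …, 4n, 1', …, (4n)'`. -/
def prev : Fin (4 * n) ⊕ Fin (4 * n) → Fin (4 * n) ⊕ Fin (4 * n)
  | Sum.inl i => if 0 < i.val then Sum.inl ⟨i.val - 1, by omega⟩
      else Sum.inr ⟨4 * n - 1, Nat.sub_lt i.pos one_pos⟩
  | Sum.inr i => if 0 < i.val then Sum.inr ⟨i.val - 1, by omega⟩
      else Sum.inl ⟨4 * n - 1, Nat.sub_lt i.pos one_pos⟩

/-- Because of the twist the two row paths close up into one Hamiltonian cycle; the rungs are its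
remaining edges. -/
theorem adj_iff (v w : Fin (4 * n) ⊕ Fin (4 * n)) :
    (moebiusOctQuad n).Adj v w ↔
      w = next v ∨ w = prev v ∨ (w = v.swap ∧ IsRung (col v).val) := by
  rcases v with i | i <;> rcases w with j | j <;>
    simp only [moebiusOctQuad, SimpleGraph.fromRel_adj, moebiusOctQuadRel, next, prev, col, IsRung,
      Sum.elim_inl, Sum.elim_inr, id, ne_eq, Sum.swap_inl, Sum.swap_inr, Sum.inl.injEq,
      Sum.inr.injEq, reduceCtorEq, not_false_eq_true, true_and, false_and, or_false, false_or] <;>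
    split_ifs <;>
    simp only [Fin.ext_iff, Sum.inl.injEq, Sum.inr.injEq, or_false, false_or] <;>
    omega

theorem next_ne_prev (v : Fin (4 * n) ⊕ Fin (4 * n)) : next v ≠ prev v := by
  rcases v with i | i <;> simp only [next, prev] <;> split_ifs <;>
    simp only [ne_eq, Fin.ext_iff, Sum.inl.injEq, Sum.inr.injEq, reduceCtorEq,
      not_false_eq_true] <;> omega

theorem swap_ne_next (v : Fin (4 * n) ⊕ Fin (4 * n)) : v.swap ≠ next v := by
  rcases v with i | i <;> simp only [next, Sum.swap_inl, Sum.swap_inr] <;> split_ifs <;>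
    simp only [ne_eq, Fin.ext_iff, Sum.inl.injEq, Sum.inr.injEq, reduceCtorEq,
      not_false_eq_true] <;> omega

theorem swap_ne_prev (v : Fin (4 * n) ⊕ Fin (4 * n)) : v.swap ≠ prev v := by
  rcases v with i | i <;> simp only [prev, Sum.swap_inl, Sum.swap_inr] <;> split_ifs <;>
    simp only [ne_eq, Fin.ext_iff, Sum.inl.injEq, Sum.inr.injEq, reduceCtorEq,
      not_false_eq_true] <;> omega

theorem sum_neighborFinset {R : Type*} [AddCommMonoid R] (v : Fin (4 * n) ⊕ Fin (4 * n))
    (F : Fin (4 * n) ⊕ Fin (4 * n) → R) :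
    ∑ w ∈ (moebiusOctQuad n).neighborFinset v, F w =
      F (next v) + F (prev v) + if IsRung (col v).val then F v.swap else 0 := by
  by_cases h : IsRung (col v).val
  · have hN : (moebiusOctQuad n).neighborFinset v = {next v, prev v, v.swap} := by
      ext w
      simp [SimpleGraph.mem_neighborFinset, adj_iff, h]
    rw [hN, sum_insert, sum_insert, sum_singleton, if_pos h, add_assoc]
    · simpa using (swap_ne_prev v).symm
    · simpa using ⟨next_ne_prev v, (swap_ne_next v).symm⟩
  · have hN : (moebiusOctQuad n).neighborFinset v = {next v, prev v} := by
      ext w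
      simp [SimpleGraph.mem_neighborFinset, adj_iff, h]
    rw [hN, sum_pair (next_ne_prev v), if_neg h, add_zero]

theorem connected (hn : 1 ≤ n) : (moebiusOctQuad n).Connected := by
  have h0 : 0 < 4 * n := by omega
  have hl : ∀ k (hk : k < 4 * n),
      (moebiusOctQuad n).Reachable (Sum.inl ⟨0, h0⟩) (Sum.inl ⟨k, hk⟩) := by
    intro k
    induction k with
    | zero => intro hk; exact SimpleGraph.Reachable.refl _
    | succ k ih =>
      intro hk
      refine (ih (by omega)).trans (SimpleGraph.Adj.reachable ((adj_iff _ _).2 (Or.inl ?_)))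
      simp [next, hk]
  have hr : ∀ k (hk : k < 4 * n),
      (moebiusOctQuad n).Reachable (Sum.inl ⟨0, h0⟩) (Sum.inr ⟨k, hk⟩) := by
    intro k
    induction k with
    | zero =>
      intro hk
      exact SimpleGraph.Adj.reachable ((adj_iff _ _).2 (Or.inr (Or.inr (by simp [col, IsRung]))))
    | succ k ih =>
      intro hk
      refine (ih (by omega)).trans (SimpleGraph.Adj.reachable ((adj_iff _ _).2 (Or.inl ?_)))
      simp [next, hk]
  rw [SimpleGraph.connected_iff_exists_forall_reachable]
  refine ⟨Sum.inl ⟨0, h0⟩, ?_⟩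
  rintro (i | i)
  exacts [hl i i.2, hr i i.2]

theorem sum_range_four_mul {R : Type*} [AddCommMonoid R] (F : ℕ → R) (n : ℕ) :
    ∑ k ∈ range (4 * n), F k =
      ∑ q ∈ range n, (F (4 * q) + F (4 * q + 1) + F (4 * q + 2) + F (4 * q + 3)) := by
  induction n with
  | zero => simp
  | succ n ih =>
    rw [show 4 * (n + 1) = 4 * n + 1 + 1 + 1 + 1 by ring, sum_range_succ, sum_range_succ,
      sum_range_succ, sum_range_succ, ih, sum_range_succ (n := n)]
    simp only [add_assoc]

theorem card_edgeFinset (n : ℕ) : (moebiusOctQuad n).edgeFinset.card = 10 * n := by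
  have hdeg : ∀ v, (moebiusOctQuad n).degree v = 2 + if IsRung (col v).val then 1 else 0 := by
    intro v
    rw [← SimpleGraph.card_neighborFinset_eq_degree, card_eq_sum_ones, sum_neighborFinset]
  have hrow : ∑ i : Fin (4 * n), (2 + if IsRung (i.val : ℤ) then 1 else 0) = 10 * n := by
    rw [Fin.sum_univ_eq_sum_range (fun k : ℕ => 2 + if IsRung (k : ℤ) then 1 else 0) (4 * n),
      sum_range_four_mul, sum_congr rfl (g := fun _ => 10)]
    · simp [mul_comm]
    · intro q _
      have h0 : IsRung ((4 * q : ℕ) : ℤ) := by unfold IsRung; omega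
      have h1 : ¬ IsRung ((4 * q + 1 : ℕ) : ℤ) := by unfold IsRung; omega
      have h2 : ¬ IsRung ((4 * q + 2 : ℕ) : ℤ) := by unfold IsRung; omega
      have h3 : IsRung ((4 * q + 3 : ℕ) : ℤ) := by unfold IsRung; omega
      simp only [h0, h1, h2, h3, if_true, if_false]
  have h := (moebiusOctQuad n).sum_degrees_eq_twice_card_edges
  rw [sum_congr rfl fun v _ => hdeg v, Fintype.sum_sum_type] at h
  change (∑ i : Fin (4 * n), (2 + if IsRung (i.val : ℤ) then 1 else 0)) +
    (∑ i : Fin (4 * n), (2 + if IsRung (i.val : ℤ) then 1 else 0)) = _ at h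
  omega

/-! ### The symmetric part: the cycle of length `m` -/

/-- A generalized inverse of the Laplacian of the cycle of length `m`. -/
noncomputable def cycleGreen (m i j : ℤ) : ℝ :=
  (((i : ℝ) - j) ^ 2 - m * |(i : ℝ) - j|) / (2 * m)

/-- The expression d² - m d is invariant under d ↦ m - d, so the formula closes up around the cycle.
-/
theorem cycleGreen_neg_one {m j : ℤ} (h0 : 0 ≤ j) (hm : j < m) :
    cycleGreen m (-1) j = cycleGreen m (m - 1) j := by
  have h0' : (0 : ℝ) ≤ j := by exact_mod_cast h0
  have hm' : (j : ℝ) + 1 ≤ m := by exact_mod_cast hm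
  unfold cycleGreen
  push_cast
  rw [abs_of_nonpos (by linarith), abs_of_nonneg (by linarith)]
  ring

theorem cycleGreen_self {m j : ℤ} (h0 : 0 ≤ j) (hm : j < m) :
    cycleGreen m m j = cycleGreen m 0 j := by
  have h0' : (0 : ℝ) ≤ j := by exact_mod_cast h0
  have hm' : (j : ℝ) + 1 ≤ m := by exact_mod_cast hm
  unfold cycleGreen
  push_cast
  rw [abs_of_nonpos (a := (0 : ℝ) - j) (by linarith), abs_of_nonneg (by linarith)]
  ring

/-- The quadratic term contributes the constant -1/m, and the kink of -|i - j|/2 contributes the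
unit mass at i = j. -/
theorem cycleGreen_laplacian {m : ℤ} (hm : 0 < m) (i j : ℤ) :
    2 * cycleGreen m i j - cycleGreen m (i + 1) j - cycleGreen m (i - 1) j =
      (if i = j then 1 else 0) - 1 / m := by
  have hm' : (m : ℝ) ≠ 0 := by exact_mod_cast hm.ne'
  unfold cycleGreen
  push_cast
  rcases lt_trichotomy i j with h | h | h
  · have h' : (i : ℝ) + 1 ≤ j := by exact_mod_cast h
    rw [abs_of_nonpos (by linarith), abs_of_nonpos (by linarith), abs_of_nonpos (by linarith),
      if_neg h.ne]
    field_simp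
    ring
  · subst h
    rw [if_pos rfl, show (i : ℝ) + 1 - i = 1 by ring, show (i : ℝ) - 1 - i = -1 by ring]
    norm_num
    field_simp
    ring
  · have h' : (j : ℝ) + 1 ≤ i := by exact_mod_cast h
    rw [abs_of_nonneg (by linarith), abs_of_nonneg (by linarith), abs_of_nonneg (by linarith),
      if_neg h.ne']
    field_simp
    ring

theorem sum_range_sq_sub (m : ℕ) :
    ∑ i ∈ range m, ((m : ℝ) - i) ^ 2 = m * (m + 1) * (2 * m + 1) / 6 := by
  induction m with
  | zero => simp
  | succ m ih =>
    rw [sum_range_succ']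
    simp only [Nat.cast_add, Nat.cast_one, add_sub_add_right_eq_sub, ih]
    push_cast
    ring

theorem sum_range_sub (m : ℕ) : ∑ i ∈ range m, ((m : ℝ) - i) = m * (m + 1) / 2 := by
  induction m with
  | zero => simp
  | succ m ih =>
    rw [sum_range_succ']
    simp only [Nat.cast_add, Nat.cast_one, add_sub_add_right_eq_sub, ih]
    push_cast
    ring

theorem sum_sum_sq_sub (m : ℕ) :
    ∑ i ∈ range m, ∑ j ∈ range m, ((i : ℝ) - j) ^ 2 = (m : ℝ) ^ 2 * ((m : ℝ) ^ 2 - 1) / 6 := by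
  induction m with
  | zero => simp
  | succ m ih =>
    have h : ∑ i ∈ range m, ((i : ℝ) - m) ^ 2 = m * (m + 1) * (2 * m + 1) / 6 := by
      rw [← sum_range_sq_sub]
      exact sum_congr rfl fun i _ => by ring
    simp only [sum_range_succ, sum_add_distrib, ih, h, sum_range_sq_sub]
    push_cast
    ring

theorem sum_sum_abs_sub (m : ℕ) :
    ∑ i ∈ range m, ∑ j ∈ range m, |(i : ℝ) - j| = (m : ℝ) * ((m : ℝ) ^ 2 - 1) / 3 := by
  induction m with
  | zero => simp
  | succ m ih =>
    have h : ∑ i ∈ range m, |(m : ℝ) - i| = m * (m + 1) / 2 := by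
      rw [← sum_range_sub]
      refine sum_congr rfl fun i hi => abs_of_nonneg ?_
      have : (i : ℝ) < m := by exact_mod_cast mem_range.1 hi
      linarith
    have h' : ∑ i ∈ range m, |(i : ℝ) - m| = m * (m + 1) / 2 := by
      rw [← h]
      exact sum_congr rfl fun i _ => abs_sub_comm _ _
    simp only [sum_range_succ, sum_add_distrib, ih, h, h', sub_self, abs_zero]
    push_cast
    ring

theorem sum_cycleGreen {m : ℕ} (hm : 0 < m) :
    ∑ i : Fin m, ∑ j : Fin m, cycleGreen m i.val j.val = - m * ((m : ℝ) ^ 2 - 1) / 12 := by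
  have hm' : (m : ℝ) ≠ 0 := by exact_mod_cast hm.ne'
  have h : ∀ i : ℕ, ∑ j : Fin m, cycleGreen m i j.val = ∑ j ∈ range m, cycleGreen m i j :=
    fun i => Fin.sum_univ_eq_sum_range (fun j : ℕ => cycleGreen m i j) m
  simp only [h]
  rw [Fin.sum_univ_eq_sum_range (fun i : ℕ => ∑ j ∈ range m, cycleGreen m i j) m]
  simp only [cycleGreen, Int.cast_natCast, ← sum_div, sum_sub_distrib, ← mul_sum, sum_sum_sq_sub,
    sum_sum_abs_sub]
  field_simp
  ring

/-! ### The antisymmetric part: a periodic Jacobi operator with antiperiodic boundary -/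

/-- The coefficients of a Floquet solution over one period. -/
def floquetCoeff (t : ℝ) (r : ℤ) : ℝ :=
  if r = 0 then 5 else if r = 1 then 11 + 2 * t else if r = 2 then 17 + 4 * t else 23 + 6 * t

/-- For `t ^ 2 = 14`, the Floquet solution with multiplier `15 + 4 t`. -/
noncomputable def floquet (t : ℝ) (k : ℤ) : ℝ := (15 + 4 * t) ^ (k / 4) * floquetCoeff t (k % 4)

theorem multiplier_mul {t : ℝ} (ht : t ^ 2 = 14) : (15 + 4 * t) * (15 + 4 * -t) = 1 := by
  linear_combination -16 * ht

theorem multiplier_ne_zero {t : ℝ} (ht : t ^ 2 = 14) : 15 + 4 * t ≠ 0 :=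
  left_ne_zero_of_mul_eq_one (multiplier_mul ht)

theorem floquet_four_mul_add (t : ℝ) (q r : ℤ) (h0 : 0 ≤ r) (h4 : r < 4) :
    floquet t (4 * q + r) = (15 + 4 * t) ^ q * floquetCoeff t r := by
  unfold floquet
  rw [show (4 * q + r) / 4 = q by omega, show (4 * q + r) % 4 = r by omega]

theorem floquet_add_four_mul {t : ℝ} (ht : t ^ 2 = 14) (k : ℤ) (n : ℕ) :
    floquet t (k + 4 * n) = (15 + 4 * t) ^ n * floquet t k := by
  unfold floquet
  rw [show (k + 4 * n) / 4 = k / 4 + n by omega, show (k + 4 * n) % 4 = k % 4 by omega,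
    zpow_add₀ (multiplier_ne_zero ht), zpow_natCast]
  ring

theorem exists_four_mul_add (k : ℤ) :
    ∃ q : ℤ, k = 4 * q + 0 ∨ k = 4 * q + 1 ∨ k = 4 * q + 2 ∨ k = 4 * q + 3 :=
  ⟨k / 4, by omega⟩

/-- Between rungs d = 2, so the coefficients form an arithmetic progression with step 6 + 2t. The
rung equations match consecutive blocks; only the one at residue 0 needs t² = 14. -/
theorem floquet_recurrence {t : ℝ} (ht : t ^ 2 = 14) (k : ℤ) :
    floquet t (k + 1) + floquet t (k - 1) = (if IsRung k then 4 else 2) * floquet t k := by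
  have hz := multiplier_ne_zero ht
  obtain ⟨q, h | h | h | h⟩ := exists_four_mul_add k
  · have hr : IsRung k := by unfold IsRung; omega
    rw [if_pos hr, h, show 4 * q + 0 + 1 = 4 * q + 1 by ring,
      show 4 * q + 0 - 1 = 4 * (q - 1) + 3 by ring]
    simp only [floquet_four_mul_add, Int.reduceLE, Int.reduceLT]
    have hq : (15 + 4 * t) ^ q = (15 + 4 * t) ^ (q - 1) * (15 + 4 * t) := by
      rw [← zpow_add_one₀ hz, sub_add_cancel]
    rw [hq]
    norm_num [floquetCoeff]
    linear_combination (15 + 4 * t) ^ (q - 1) * 8 * ht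
  · have hr : ¬ IsRung k := by unfold IsRung; omega
    rw [if_neg hr, h, show 4 * q + 1 + 1 = 4 * q + 2 by ring,
      show 4 * q + 1 - 1 = 4 * q + 0 by ring]
    simp only [floquet_four_mul_add, Int.reduceLE, Int.reduceLT]
    norm_num [floquetCoeff]
    ring
  · have hr : ¬ IsRung k := by unfold IsRung; omega
    rw [if_neg hr, h, show 4 * q + 2 + 1 = 4 * q + 3 by ring,
      show 4 * q + 2 - 1 = 4 * q + 1 by ring]
    simp only [floquet_four_mul_add, Int.reduceLE, Int.reduceLT]
    norm_num [floquetCoeff]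
    ring
  · have hr : IsRung k := by unfold IsRung; omega
    rw [if_pos hr, h, show 4 * q + 3 + 1 = 4 * (q + 1) + 0 by ring,
      show 4 * q + 3 - 1 = 4 * q + 2 by ring]
    simp only [floquet_four_mul_add, Int.reduceLE, Int.reduceLT]
    rw [zpow_add_one₀ hz]
    norm_num [floquetCoeff]
    ring

/-- Both solutions obey the same recurrence, so the Wronskian is constant; its value is read off at
0 and 1. -/
theorem floquet_wronskian {t : ℝ} (ht : t ^ 2 = 14) (k : ℤ) :
    floquet t k * floquet (-t) (k - 1) - floquet t (k - 1) * floquet (-t) k = 20 * t := by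
  have ht' : (-t) ^ 2 = 14 := by rw [neg_sq, ht]
  have hstep : ∀ k, floquet t (k + 1) * floquet (-t) k - floquet t k * floquet (-t) (k + 1) =
      floquet t k * floquet (-t) (k - 1) - floquet t (k - 1) * floquet (-t) k := by
    intro k
    linear_combination floquet (-t) k * floquet_recurrence ht k
      - floquet t k * floquet_recurrence ht' k
  have hbase : floquet t 1 * floquet (-t) 0 - floquet t 0 * floquet (-t) 1 = 20 * t := by
    norm_num [floquet, floquetCoeff]
    ring
  induction k using Int.induction_on with
  | zero => rw [← hstep]; simpa using hbase
  | succ k ih => rw [add_sub_cancel_right, hstep, ih]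
  | pred k ih =>
    have h := hstep (-(k : ℤ) - 1)
    rw [sub_add_cancel] at h
    rw [← h, ih]

/-- The reciprocal multipliers cancel, leaving 964 - 56 t² = 180 in every block. -/
theorem floquet_mul_neg_sum {t : ℝ} (ht : t ^ 2 = 14) (q : ℤ) :
    floquet t (4 * q) * floquet (-t) (4 * q) + floquet t (4 * q + 1) * floquet (-t) (4 * q + 1) +
      floquet t (4 * q + 2) * floquet (-t) (4 * q + 2) +
      floquet t (4 * q + 3) * floquet (-t) (4 * q + 3) = 180 := by
  have hq : (15 + 4 * t) ^ q * (15 + 4 * -t) ^ q = 1 := by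
    rw [← mul_zpow, multiplier_mul ht, one_zpow]
  have h0 : ∀ s, floquet s (4 * q) = (15 + 4 * s) ^ q * floquetCoeff s 0 := fun s => by
    simpa using floquet_four_mul_add s q 0 (by norm_num) (by norm_num)
  simp only [floquet_four_mul_add, h0, Int.reduceLE, Int.reduceLT]
  norm_num [floquetCoeff] at hq ⊢
  linear_combination (868 - 56 * t ^ 2 + 96) * hq - 56 * ht

/-- The Green function of the antiperiodic Jacobi operator with period `4 n`. -/
noncomputable def antiGreen (n : ℕ) (t : ℝ) (i j : ℤ) : ℝ :=
  (floquet (-t) (max i j) * floquet t (min i j) / (1 + (15 + 4 * -t) ^ n) -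
    floquet t (max i j) * floquet (-t) (min i j) / (1 + (15 + 4 * t) ^ n)) / (20 * t)

theorem multiplier_pos {t : ℝ} (ht : t ^ 2 = 14) : 0 < 15 + 4 * t := by
  nlinarith [sq_nonneg (t + 15 / 4)]

theorem one_add_multiplier_pow_ne_zero {t : ℝ} (ht : t ^ 2 = 14) (n : ℕ) :
    1 + (15 + 4 * t) ^ n ≠ 0 := by
  have := pow_pos (multiplier_pos ht) n
  positivity

theorem inv_one_add_multiplier_pow {t : ℝ} (ht : t ^ 2 = 14) (n : ℕ) :
    (15 + 4 * t) ^ n / (1 + (15 + 4 * t) ^ n) = 1 / (1 + (15 + 4 * -t) ^ n) := by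
  have ht' : (-t) ^ 2 = 14 := by rw [neg_sq, ht]
  have hab : (15 + 4 * t) ^ n * (15 + 4 * -t) ^ n = 1 := by
    rw [← mul_pow, multiplier_mul ht, one_pow]
  rw [div_eq_div_iff (one_add_multiplier_pow_ne_zero ht n) (one_add_multiplier_pow_ne_zero ht' n)]
  linear_combination hab

theorem antiGreen_of_le {i j : ℤ} (h : j ≤ i) (n : ℕ) (t : ℝ) :
    antiGreen n t i j = (floquet (-t) i * floquet t j / (1 + (15 + 4 * -t) ^ n) -
      floquet t i * floquet (-t) j / (1 + (15 + 4 * t) ^ n)) / (20 * t) := by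
  rw [antiGreen, max_eq_left h, min_eq_right h]

theorem antiGreen_of_ge {i j : ℤ} (h : i ≤ j) (n : ℕ) (t : ℝ) :
    antiGreen n t i j = (floquet (-t) j * floquet t i / (1 + (15 + 4 * -t) ^ n) -
      floquet t j * floquet (-t) i / (1 + (15 + 4 * t) ^ n)) / (20 * t) := by
  rw [antiGreen, max_eq_right h, min_eq_left h]

/-- Shifting by a full period interchanges max and min, and the multipliers it produces turn each
weight into the other; the minus sign is the antiperiodicity. -/
theorem antiGreen_add_period {t : ℝ} (ht : t ^ 2 = 14) {n : ℕ} {i j : ℤ} (h : i ≤ j)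
    (h' : j ≤ i + 4 * n) : antiGreen n t (i + 4 * n) j = -antiGreen n t i j := by
  have ht' : (-t) ^ 2 = 14 := by rw [neg_sq, ht]
  have e1 := inv_one_add_multiplier_pow ht n
  have e2 := inv_one_add_multiplier_pow ht' n
  rw [neg_neg] at e2
  rw [antiGreen_of_le h', antiGreen_of_ge h, floquet_add_four_mul ht, floquet_add_four_mul ht',
    ← neg_div]
  congr 1
  linear_combination floquet (-t) i * floquet t j * e2 - floquet t i * floquet (-t) j * e1

/-- Off the diagonal this is the recurrence in `i`. On it, the two branches differ by a jump equal
to the Wronskian, normalised by 20t. -/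
theorem antiGreen_laplacian {t : ℝ} (ht : t ^ 2 = 14) (n : ℕ) (i j : ℤ) :
    (if IsRung i then 4 else 2) * antiGreen n t i j - antiGreen n t (i + 1) j -
      antiGreen n t (i - 1) j = if i = j then 1 else 0 := by
  have ht' : (-t) ^ 2 = 14 := by rw [neg_sq, ht]
  have hr := floquet_recurrence ht i
  have hr' := floquet_recurrence ht' i
  set d : ℝ := if IsRung i then 4 else 2
  rcases lt_trichotomy i j with h | h | h
  · rw [if_neg h.ne, antiGreen_of_ge h.le, antiGreen_of_ge (by omega : i + 1 ≤ j),
      antiGreen_of_ge (by omega : i - 1 ≤ j)]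
    linear_combination
      -(floquet (-t) j / (1 + (15 + 4 * -t) ^ n) / (20 * t)) * hr +
        (floquet t j / (1 + (15 + 4 * t) ^ n) / (20 * t)) * hr'
  · subst h
    have hw := floquet_wronskian ht i
    have e1 := inv_one_add_multiplier_pow ht n
    have h0 : t ≠ 0 := by rintro rfl; norm_num at ht
    have ha := one_add_multiplier_pow_ne_zero ht n
    -- Since μν = 1, the two weights sum to one, which makes the jump exactly 1.
    have hab : 1 / (1 + (15 + 4 * -t) ^ n) + 1 / (1 + (15 + 4 * t) ^ n) = 1 := by
      rw [← e1, ← add_div, add_comm, div_self ha]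
    have ht20 : 1 / (20 * t) * (20 * t) = 1 := by field_simp
    rw [if_pos rfl, antiGreen_of_le le_rfl, antiGreen_of_le (by omega : i ≤ i + 1),
      antiGreen_of_ge (by omega : i - 1 ≤ i)]
    linear_combination
      -(floquet t i / (1 + (15 + 4 * -t) ^ n) / (20 * t)) * hr' +
        (floquet (-t) i / (1 + (15 + 4 * t) ^ n) / (20 * t)) * hr +
        (1 / (1 + (15 + 4 * -t) ^ n) + 1 / (1 + (15 + 4 * t) ^ n)) / (20 * t) * hw +
        1 / (20 * t) * (20 * t) * hab + ht20
  · rw [if_neg h.ne', antiGreen_of_le h.le, antiGreen_of_le (by omega : j ≤ i + 1),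
      antiGreen_of_le (by omega : j ≤ i - 1)]
    linear_combination
      -(floquet t j / (1 + (15 + 4 * -t) ^ n) / (20 * t)) * hr' +
        (floquet (-t) j / (1 + (15 + 4 * t) ^ n) / (20 * t)) * hr

theorem trace_antiGreen {t : ℝ} (ht : t ^ 2 = 14) (n : ℕ) :
    ∑ i : Fin (4 * n), antiGreen n t i.val i.val =
      9 * n * t / 14 * (((15 + 4 * t) ^ n - (15 + 4 * -t) ^ n) /
        ((15 + 4 * t) ^ n + (15 + 4 * -t) ^ n + 2)) := by
  have ht' : (-t) ^ 2 = 14 := by rw [neg_sq, ht]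
  have h0 : t ≠ 0 := by rintro rfl; norm_num at ht
  have ha := one_add_multiplier_pow_ne_zero ht n
  have hb := one_add_multiplier_pow_ne_zero ht' n
  have hab : (15 + 4 * t) ^ n * (15 + 4 * -t) ^ n = 1 := by
    rw [← mul_pow, multiplier_mul ht, one_pow]
  rw [Fin.sum_univ_eq_sum_range (fun i : ℕ => antiGreen n t i i) (4 * n), sum_range_four_mul]
  have hdiag : ∀ i : ℤ, antiGreen n t i i = floquet t i * floquet (-t) i *
      ((1 / (1 + (15 + 4 * -t) ^ n) - 1 / (1 + (15 + 4 * t) ^ n)) / (20 * t)) := by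
    intro i
    rw [antiGreen_of_le le_rfl]
    ring
  have hblock : ∀ q : ℕ, antiGreen n t (4 * q : ℕ) (4 * q : ℕ) +
      antiGreen n t (4 * q + 1 : ℕ) (4 * q + 1 : ℕ) +
      antiGreen n t (4 * q + 2 : ℕ) (4 * q + 2 : ℕ) +
      antiGreen n t (4 * q + 3 : ℕ) (4 * q + 3 : ℕ) =
      180 * ((1 / (1 + (15 + 4 * -t) ^ n) - 1 / (1 + (15 + 4 * t) ^ n)) / (20 * t)) := by
    intro q
    simp only [hdiag, ← add_mul]
    push_cast
    rw [floquet_mul_neg_sum ht]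
  have hden : (15 + 4 * t) ^ n + (15 + 4 * -t) ^ n + 2 =
      (1 + (15 + 4 * t) ^ n) * (1 + (15 + 4 * -t) ^ n) := by
    linear_combination -hab
  rw [sum_congr rfl fun q _ => hblock q, sum_const, card_range, nsmul_eq_mul, hden]
  generalize (15 + 4 * t) ^ n = a at *
  generalize (15 + 4 * -t) ^ n = b at *
  field_simp
  -- The Wronskian leaves 9n/t, and t² = 14 turns 1/t into t/14.
  linear_combination -180 * n * (a - b) * ht

/-! ### The generalized inverse of the Laplacian of the network -/

/-- A generalized inverse of the Laplacian, assembled from the symmetric and the antisymmetric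
part. -/
noncomputable def green (n : ℕ) (t : ℝ) (v w : Fin (4 * n) ⊕ Fin (4 * n)) : ℝ :=
  (cycleGreen (4 * n) (col v).val (col w).val +
    sgn v * sgn w * antiGreen n t (col v).val (col w).val) / 2

/-- The sign flips exactly at the seam, which is where antiperiodicity enters. -/
theorem col_next_cases (v : Fin (4 * n) ⊕ Fin (4 * n)) :
    (((col (next v)).val : ℤ) = (col v).val + 1 ∧ sgn (next v) = sgn v) ∨
      (((col v).val : ℤ) + 1 = 4 * n ∧ (col (next v)).val = 0 ∧ sgn (next v) = -sgn v) := by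
  rcases v with i | i <;> by_cases h : i.val + 1 < 4 * n
  · left; simp [next, h, col, sgn]
  · right
    have := i.2
    refine ⟨?_, by simp [next, h, col], by simp [next, h, sgn]⟩
    simp only [col, Sum.elim_inl, id]
    omega
  · left; simp [next, h, col, sgn]
  · right
    have := i.2
    refine ⟨?_, by simp [next, h, col], by simp [next, h, sgn]⟩
    simp only [col, Sum.elim_inr, id]
    omega

theorem col_prev_cases (v : Fin (4 * n) ⊕ Fin (4 * n)) :
    (((col (prev v)).val : ℤ) = (col v).val - 1 ∧ sgn (prev v) = sgn v) ∨
      ((col v).val = 0 ∧ ((col (prev v)).val : ℤ) = 4 * n - 1 ∧ sgn (prev v) = -sgn v) := by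
  rcases v with i | i <;> by_cases h : 0 < i.val
  · left
    refine ⟨?_, by simp [prev, h, sgn]⟩
    simp only [prev, if_pos h, col, Sum.elim_inl, id]
    omega
  · right
    have := i.2
    refine ⟨by simpa [col] using h, ?_, by simp [prev, h, sgn]⟩
    simp only [prev, if_neg h, col, Sum.elim_inr, id]
    omega
  · left
    refine ⟨?_, by simp [prev, h, sgn]⟩
    simp only [prev, if_pos h, col, Sum.elim_inr, id]
    omega
  · right
    have := i.2
    refine ⟨by simpa [col] using h, ?_, by simp [prev, h, sgn]⟩
    simp only [prev, if_neg h, col, Sum.elim_inl, id]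
    omega

theorem cycleGreen_next (v : Fin (4 * n) ⊕ Fin (4 * n)) (j : Fin (4 * n)) :
    cycleGreen (4 * n) (col (next v)).val j.val =
      cycleGreen (4 * n) ((col v).val + 1) j.val := by
  obtain ⟨h, -⟩ | ⟨h, h', -⟩ := col_next_cases v
  · rw [h]
  · rw [h, h', cycleGreen_self (by omega) (by omega), Nat.cast_zero]

theorem cycleGreen_prev (v : Fin (4 * n) ⊕ Fin (4 * n)) (j : Fin (4 * n)) :
    cycleGreen (4 * n) (col (prev v)).val j.val =
      cycleGreen (4 * n) ((col v).val - 1) j.val := by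
  obtain ⟨h, -⟩ | ⟨h, h', -⟩ := col_prev_cases v
  · rw [h]
  · rw [h, h', Nat.cast_zero, zero_sub, cycleGreen_neg_one (by omega) (by omega)]

theorem antiGreen_next {t : ℝ} (ht : t ^ 2 = 14) (v : Fin (4 * n) ⊕ Fin (4 * n))
    (j : Fin (4 * n)) :
    sgn (next v) * antiGreen n t (col (next v)).val j.val =
      sgn v * antiGreen n t ((col v).val + 1) j.val := by
  obtain ⟨h, hs⟩ | ⟨h, h', hs⟩ := col_next_cases v
  · rw [h, hs]
  · have := antiGreen_add_period ht (n := n) (i := 0) (j := j.val) (by omega) (by omega)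
    rw [zero_add] at this
    rw [h, h', hs, this, Nat.cast_zero]
    ring

theorem antiGreen_prev {t : ℝ} (ht : t ^ 2 = 14) (v : Fin (4 * n) ⊕ Fin (4 * n))
    (j : Fin (4 * n)) :
    sgn (prev v) * antiGreen n t (col (prev v)).val j.val =
      sgn v * antiGreen n t ((col v).val - 1) j.val := by
  obtain ⟨h, hs⟩ | ⟨h, h', hs⟩ := col_prev_cases v
  · rw [h, hs]
  · have := antiGreen_add_period ht (n := n) (i := -1) (j := j.val) (by omega) (by omega)
    rw [neg_add_eq_sub] at this
    rw [h, h', hs, this, Nat.cast_zero, zero_sub]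
    ring

/-- A rung adds nothing to the symmetric part and 2 to the diagonal of the antisymmetric part, hence
d = 4. Averaging the two parts halves the cycle's drain 1/(4n). -/
theorem green_laplacian {t : ℝ} (ht : t ^ 2 = 14) (v j : Fin (4 * n) ⊕ Fin (4 * n)) :
    ∑ w ∈ (moebiusOctQuad n).neighborFinset v, (green n t v j - green n t w j) =
      (if v = j then 1 else 0) - 1 / (8 * n) := by
  have hpos : (0 : ℤ) < 4 * n := by
    have := (col v).pos
    omega
  have hS := cycleGreen_laplacian hpos (col v).val (col j).val
  have hA := antiGreen_laplacian ht n (col v).val (col j).val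
  -- The factor (1 + sgn v sgn j)/2 tests whether both vertices lie in the same row.
  have hdelta : (if v = j then (1 : ℝ) else 0) =
      (1 + sgn v * sgn j) / 2 * if ((col v).val : ℤ) = (col j).val then 1 else 0 := by
    rcases v with i | i <;> rcases j with k | k <;> simp [sgn, col, Fin.ext_iff]
  have hswap : green n t v j - green n t v.swap j =
      sgn v * sgn j * antiGreen n t (col v).val (col j).val := by
    rcases v with i | i <;> simp only [green, sgn, col, Sum.swap_inl, Sum.swap_inr, Sum.elim_inl,
      Sum.elim_inr, id] <;> ring
  rw [sum_neighborFinset, hswap, hdelta]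
  simp only [green]
  rw [cycleGreen_next, cycleGreen_prev, mul_right_comm (sgn (next v)),
    mul_right_comm (sgn (prev v)), antiGreen_next ht, antiGreen_prev ht]
  have hn : (1 : ℝ) / (8 * n) = 1 / (4 * n : ℤ) / 2 := by
    push_cast
    rw [div_div]
    ring_nf
  rw [hn]
  by_cases hr : IsRung (col v).val
  · rw [if_pos hr] at hA ⊢
    linear_combination hS / 2 + sgn v * sgn j / 2 * hA
  · rw [if_neg hr] at hA ⊢
    linear_combination hS / 2 + sgn v * sgn j / 2 * hA

theorem trace_green (n : ℕ) (t : ℝ) :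
    ∑ v, green n t v v = ∑ i : Fin (4 * n), antiGreen n t i.val i.val := by
  rw [Fintype.sum_sum_type, ← sum_add_distrib]
  refine sum_congr rfl fun i _ => ?_
  simp [green, sgn, col, cycleGreen]

theorem sum_green (hn : 1 ≤ n) (t : ℝ) :
    ∑ v, ∑ w, green n t v w = -(8 * n) * ((4 * n : ℝ) ^ 2 - 1) / 12 := by
  have h := sum_cycleGreen (m := 4 * n) (by omega)
  have hrow : ∀ v, ∑ w, green n t v w =
      ∑ j : Fin (4 * n), cycleGreen (4 * n) (col v).val j.val := by
    intro v
    rw [Fintype.sum_sum_type, ← sum_add_distrib]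
    refine sum_congr rfl fun i _ => ?_
    simp only [green, sgn, col, Sum.elim_inl, Sum.elim_inr, id]
    ring
  simp only [hrow, Fintype.sum_sum_type, col, Sum.elim_inl, Sum.elim_inr, id]
  push_cast at h
  rw [h]
  ring

end MoebiusOctQuad

theorem mainTheorem1 (n : ℕ) (hn : 1 ≤ n) (μ ν : ℝ)
    (hμ : μ = 15 + 4 * Real.sqrt 14) (hν : ν = 15 - 4 * Real.sqrt 14) :
    (moebiusOctQuad n).Connected ∧
    Fintype.card (Fin (4 * n) ⊕ Fin (4 * n)) = 8 * n ∧
    (moebiusOctQuad n).edgeFinset.card = 10 * n ∧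
    kirchhoffIndex (moebiusOctQuad n) =
      (32 * (n : ℝ) ^ 3 - 2 * (n : ℝ)) / 3 +
        36 * (n : ℝ) ^ 2 * Real.sqrt 14 / 7 * ((μ ^ n - ν ^ n) / (μ ^ n + ν ^ n + 2)) := by
  have ht : Real.sqrt 14 ^ 2 = 14 := Real.sq_sqrt (by norm_num)
  have hν' : ν = 15 + 4 * -Real.sqrt 14 := by rw [hν]; ring
  have hcard : Fintype.card (Fin (4 * n) ⊕ Fin (4 * n)) = 8 * n := by
    rw [Fintype.card_sum, Fintype.card_fin]
    ring
  refine ⟨MoebiusOctQuad.connected hn, hcard, MoebiusOctQuad.card_edgeFinset n, ?_⟩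
  rw [kirchhoffIndex_eq_of_generalizedInverse _ (MoebiusOctQuad.green n (Real.sqrt 14)) _
    (MoebiusOctQuad.green_laplacian ht), MoebiusOctQuad.trace_green,
    MoebiusOctQuad.trace_antiGreen ht, MoebiusOctQuad.sum_green hn, hcard, hμ, hν']
  push_cast
  ring
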